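/- For two-component vectors put $\langle \mathbf u,\mathbf w\rangle=u_1w_2+u_2w_1$. Let $x_1<x_2$ and let $\mathbf m_1,\mathbf m_2\in\mathbb R^2$ have positive entries. With $\mathbf m=2\sum_{k=1}^2\mathbf m_k\delta_{x_k}$ and $z\in\mathbb C$ consider the system $$\partial_x\phi_1=z\langle\mathbf m,\boldsymbol\phi_2\rangle+\phi_3,\qquad \partial_x\boldsymbol\phi_2=z\,\mathbf m\,\phi_3,\qquad \partial_x\phi_3=\phi_1,$$ in the sense of distributions, where $\boldsymbol\phi_2$ is $\mathbb C^2$-valued and the product $\langle\mathbf m,\boldsymbol\phi_2\rangle$ is formed with the average of the one-sided limits of $\boldsymbol\phi_2$ at each $x_k$. The number $z$ is called an eigenvalue if there is a nontrivial solution with $\phi_3(-\infty)=0$, $\boldsymbol\phi_2(-\infty)=0$, $\phi_3(+\infty)=0$. The solution with $\phi_1=\phi_3=e^x$, $\boldsymbol\phi_2=0$ for $x<x_1$ has, for $x>x_2$ and with $\lambda=-z^2$, the form $$\phi_1=A(\lambda)e^x-\lambda C(\lambda)e^{-x},\qquad \boldsymbol\phi_2=2z\mathbf B(\lambda),\qquad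 \phi_3=A(\lambda)e^x+\lambda C(\lambda)e^{-x}$$ with polynomials $A,\mathbf B,C$. The spectral data of $(x_k,\mathbf m_k)_{k=1,2}$ are the numbers $\lambda_1>\lambda_2$ that are the values of $-z^2$ at the eigenvalues $z$, together with the vectors $\mathbf b_1,\mathbf b_2$ in the decomposition $-\mathbf B(\lambda)/A(\lambda)=\sum_{k=1}^2\mathbf b_k/(\lambda-\lambda_k)$. Let $\mathcal S(2)$ be the set of all spectral data $(\lambda_1,\lambda_2,\mathbf b_1,\mathbf b_2)$ that arise from such $x_1<x_2$ and $\mathbf m_1,\mathbf m_2$. Theorem. Let $\lambda_1>\lambda_2>0$ and let $\mathbf b_1,\mathbf b_2\in\mathbb R^2$ have positive entries. Then the following are equivalent: 1. $(\lambda_1,\lambda_2,\mathbf b_1,\mathbf b_2)\in\mathcal S(2)$. 2. $\langle\mathbf b_1,\mathcal L\mathbf b_2\rangle>0$ and $\langle\mathbf b_2,\mathcal L\mathbf b_1\rangle>0$, where $\mathcal L=\mathrm{diag}(\lambda_1,-\lambda_2)$. 3. Both components of the vector $$\mathbf G_2^{(1,0)}=\det\begin{pmatrix}\boldsymbol\beta_0&I_{1,0}\\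 \boldsymbol\beta_1&I_{2,0}\end{pmatrix}=\boldsymbol\beta_0I_{2,0}-\boldsymbol\beta_1I_{1,0}$$ are positive, where $\boldsymbol\beta_j=\sum_{p=1}^2\lambda_p^j\mathbf b_p$ and $I_{i,j}=\sum_{p,q=1}^2\frac{\lambda_p^i\lambda_q^j}{\lambda_p+\lambda_q}\langle\mathbf b_p,\mathbf b_q\rangle$. 4. The matrix $$\Lambda_2(2)=\begin{pmatrix}\frac{\mathbf b_2}{\lambda_2}&\frac{\langle\mathbf b_2,\mathbf b_2\rangle}{\lambda_2+\lambda_2}&\frac{\langle\mathbf b_2,\mathbf b_1\rangle}{\lambda_2+\lambda_1}\\ \frac{\mathbf b_1}{\lambda_1}&\frac{\langle\mathbf b_1,\mathbf b_2\rangle}{\lambda_1+\lambda_2}&\frac{\langle\mathbf b_1,\mathbf b_1\rangle}{\lambda_1+\lambda_1}\end{pmatrix},$$ whose first column is vector-valued, is totally positive: the determinant of each of its square submatrices is positive (componentwise when the submatrix contains the vector-valued column and the determinant is therefore a vector). -/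

import Mathlib

open scoped Polynomial

namespace NV2

/-- The symmetric bilinear form `⟨u, w⟩ = u₁ w₂ + u₂ w₁` on two-component vectors. -/
def pairing {R : Type*} [CommRing R] (u w : Fin 2 → R) : R := u 0 * w 1 + u 1 * w 0

/-- `φ = (φ₁, φ₂, φ₃)`, with `φ₂` two-component, solves
`∂ₓφ₁ = z ⟨𝐦, φ₂⟩ + φ₃`, `∂ₓφ₂ = z φ₃ 𝐦`, `∂ₓφ₃ = φ₁` in the sense of distributions,
where `𝐦 = 2 ∑ₖ mₖ δ_{xₖ}` and `⟨𝐦, φ₂⟩` is formed with the average of the one-sided limits of `φ₂`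
at each `xₖ`. Spelled out: the equations hold classically away from the points `xₖ`, `φ₃` is
continuous, and at `xₖ` the function `φ₂` jumps by `2 z φ₃(xₖ) mₖ` and `φ₁` jumps by
`2 z ⟨mₖ, φ₂(xₖ)⟩`; the value of `φ₁` and of `φ₂` at `xₖ` is the average of the one-sided limits. -/
structure IsLaxSolution {N : ℕ} (x : Fin N → ℝ) (m : Fin N → Fin 2 → ℝ) (z : ℂ)
    (φ₁ : ℝ → ℂ) (φ₂ : ℝ → Fin 2 → ℂ) (φ₃ : ℝ → ℂ) : Prop where
  deriv₁ : ∀ y, (∀ k, y ≠ x k) → HasDerivAt φ₁ (φ₃ y) y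
  deriv₂ : ∀ y, (∀ k, y ≠ x k) → HasDerivAt φ₂ 0 y
  deriv₃ : ∀ y, (∀ k, y ≠ x k) → HasDerivAt φ₃ (φ₁ y) y
  continuous₃ : Continuous φ₃
  jump₁ : ∀ k, ∃ l r : ℂ,
    Filter.Tendsto φ₁ (nhdsWithin (x k) (Set.Iio (x k))) (nhds l) ∧
    Filter.Tendsto φ₁ (nhdsWithin (x k) (Set.Ioi (x k))) (nhds r) ∧
    φ₁ (x k) = (l + r) / 2 ∧
    r - l = 2 * z * pairing (fun a => (m k a : ℂ)) (φ₂ (x k))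
  jump₂ : ∀ k, ∃ l r : Fin 2 → ℂ,
    Filter.Tendsto φ₂ (nhdsWithin (x k) (Set.Iio (x k))) (nhds l) ∧
    Filter.Tendsto φ₂ (nhdsWithin (x k) (Set.Ioi (x k))) (nhds r) ∧
    (∀ a, φ₂ (x k) a = (l a + r a) / 2) ∧
    ∀ a, r a - l a = 2 * z * φ₃ (x k) * (m k a : ℂ)

/-- `z` is an eigenvalue of the boundary value problem: there is a nontrivial solution with
`φ₃(-∞) = 0`, `φ₂(-∞) = 0` and `φ₃(+∞) = 0`. -/
def IsEigenvalue {N : ℕ} (x : Fin N → ℝ) (m : Fin N → Fin 2 → ℝ) (z : ℂ) : Prop :=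
  ∃ (φ₁ : ℝ → ℂ) (φ₂ : ℝ → Fin 2 → ℂ) (φ₃ : ℝ → ℂ),
    IsLaxSolution x m z φ₁ φ₂ φ₃ ∧
    (φ₁ ≠ 0 ∨ φ₂ ≠ 0 ∨ φ₃ ≠ 0) ∧
    Filter.Tendsto φ₃ Filter.atBot (nhds 0) ∧
    Filter.Tendsto φ₂ Filter.atBot (nhds 0) ∧
    Filter.Tendsto φ₃ Filter.atTop (nhds 0)

/-- The polynomials `A`, `B = (B₁, B₂)`, `C` in `λ = -z²` describe, to the right of all `xₖ`, the
solution that equals `φ₁ = φ₃ = eʸ`, `φ₂ = 0` to the left of all `xₖ`: there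
`φ₁ = A(λ) eʸ - λ C(λ) e⁻ʸ`, `φ₂ = 2 z B(λ)`, `φ₃ = A(λ) eʸ + λ C(λ) e⁻ʸ`. -/
def IsScattering {N : ℕ} (x : Fin N → ℝ) (m : Fin N → Fin 2 → ℝ)
    (A : ℂ[X]) (B : Fin 2 → ℂ[X]) (C : ℂ[X]) : Prop :=
  ∀ z : ℂ, ∃ (φ₁ : ℝ → ℂ) (φ₂ : ℝ → Fin 2 → ℂ) (φ₃ : ℝ → ℂ),
    IsLaxSolution x m z φ₁ φ₂ φ₃ ∧
    (∀ y : ℝ, (∀ k, y < x k) →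
      φ₁ y = Complex.exp y ∧ φ₂ y = 0 ∧ φ₃ y = Complex.exp y) ∧
    (∀ y : ℝ, (∀ k, x k < y) →
      φ₁ y = A.eval (-z ^ 2) * Complex.exp y - (-z ^ 2) * C.eval (-z ^ 2) * Complex.exp (-y) ∧
      (∀ a, φ₂ y a = 2 * z * (B a).eval (-z ^ 2)) ∧
      φ₃ y = A.eval (-z ^ 2) * Complex.exp y + (-z ^ 2) * C.eval (-z ^ 2) * Complex.exp (-y))

/-- `(lam, b)` is the spectral data of the boundary value problem with positions `x` and
masses `m`: the numbers `λ₁ > ⋯ > λ_N` are exactly the values `-z²` at the eigenvalues `z`, and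
`bₖ` is the residue at `λₖ` of the Weyl function `W = -B/A`, i.e. `W(ζ) = ∑ₖ bₖ / (ζ - λₖ)`. -/
def HasSpectralData {N : ℕ} (x : Fin N → ℝ) (m : Fin N → Fin 2 → ℝ)
    (lam : Fin N → ℝ) (b : Fin N → Fin 2 → ℝ) : Prop :=
  StrictAnti lam ∧
  {ζ : ℂ | ∃ z : ℂ, IsEigenvalue x m z ∧ ζ = -z ^ 2} = Set.range (fun k => (lam k : ℂ)) ∧
  ∃ (A : ℂ[X]) (B : Fin 2 → ℂ[X]) (C : ℂ[X]), IsScattering x m A B C ∧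
    ∀ ζ : ℂ, A.eval ζ ≠ 0 → ∀ a,
      -((B a).eval ζ / A.eval ζ) = ∑ k, (b k a : ℂ) / (ζ - (lam k : ℂ))

/-- The actual spectral data `𝒮(N)`: all spectral data of boundary value problems
with `x₁ < ⋯ < x_N` and positive masses. -/
def spectralData (N : ℕ) : Set ((Fin N → ℝ) × (Fin N → Fin 2 → ℝ)) :=
  {p | ∃ (x : Fin N → ℝ) (m : Fin N → Fin 2 → ℝ),
    StrictMono x ∧ (∀ k a, 0 < m k a) ∧ HasSpectralData x m p.1 p.2}

/-- The extended spectral data `𝒮_ext(N)`: `λ₁ > ⋯ > λ_N > 0` and `bⱼ > 0`. -/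
def extendedSpectralData (N : ℕ) : Set ((Fin N → ℝ) × (Fin N → Fin 2 → ℝ)) :=
  {p | StrictAnti p.1 ∧ (∀ k, 0 < p.1 k) ∧ ∀ k a, 0 < p.2 k a}

/-- The determinant of a square matrix whose first column `v` has vector entries and whose other
columns, collected in `M`, are scalar. As each term of the Leibniz sum contains
exactly one vector entry, it is computed componentwise. -/
noncomputable def vecDet {n : ℕ} (v : Fin (n + 1) → Fin 2 → ℝ)
    (M : Matrix (Fin (n + 1)) (Fin n) ℝ) : Fin 2 → ℝ :=
  fun a => Matrix.det (Matrix.of fun p : Fin (n + 1) =>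
    (Fin.cons (v p a) (M p) : Fin (n + 1) → ℝ))

/-- The moments `βⱼ = ∑ₚ λₚʲ bₚ`. -/
noncomputable def vecMoment {N : ℕ} (lam : Fin N → ℝ) (b : Fin N → Fin 2 → ℝ) (j : ℤ) :
    Fin 2 → ℝ :=
  fun a => ∑ p, lam p ^ j * b p a

/-- The moments `I_{i,j} = ∑ₚ ∑_q λₚⁱ λ_qʲ ⟨bₚ, b_q⟩ / (λₚ + λ_q)`. -/
noncomputable def biMoment {N : ℕ} (lam : Fin N → ℝ) (b : Fin N → Fin 2 → ℝ) (i j : ℤ) : ℝ :=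
  ∑ p, ∑ q, lam p ^ i * lam q ^ j / (lam p + lam q) * pairing (b p) (b q)

/-- `G_k^{(i,j)}`: the `k × k` determinant with first column `β_{i+p-1}` and remaining
entries `I_{i+p,j+q}`, `0 ≤ p ≤ k-1`, `0 ≤ q ≤ k-2`; it is zero for `k = 0`. -/
noncomputable def G {N : ℕ} (lam : Fin N → ℝ) (b : Fin N → Fin 2 → ℝ) :
    ℕ → ℤ → ℤ → Fin 2 → ℝ
  | 0, _, _ => 0
  | n + 1, i, j => vecDet (fun p : Fin (n + 1) => vecMoment lam b (i + (p : ℕ) - 1))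
      (Matrix.of fun (p : Fin (n + 1)) (q : Fin n) =>
        biMoment lam b (i + (p : ℕ)) (j + (q : ℕ)))

/-- The first column of `Λ₂(N)`: the vectors `bₖ / λₖ`, `k = N, …, 1` from top to bottom. -/
noncomputable def lambda2Vec {N : ℕ} (lam : Fin N → ℝ) (b : Fin N → Fin 2 → ℝ) :
    Fin N → Fin 2 → ℝ :=
  fun p a => b p.rev a / lam p.rev

/-- The remaining columns of `Λ₂(N)`: `⟨bₖ, bₗ⟩ / (λₖ + λₗ)`, rows `k = N, …, 1` and
columns `l = N, …, 1`. -/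
noncomputable def lambda2Mat {N : ℕ} (lam : Fin N → ℝ) (b : Fin N → Fin 2 → ℝ) :
    Matrix (Fin N) (Fin N) ℝ :=
  Matrix.of fun p q => pairing (b p.rev) (b q.rev) / (lam p.rev + lam q.rev)

/-- Total positivity of a matrix `(v | M)` with one vector-valued column `v`, placed first: the
determinant of every square submatrix is positive, componentwise if it
is vector-valued. -/
def IsTotallyPositive {r s : ℕ} (v : Fin r → Fin 2 → ℝ) (M : Matrix (Fin r) (Fin s) ℝ) : Prop :=
  (∀ (k : ℕ) (f : Fin k → Fin r) (g : Fin k → Fin s), StrictMono f → StrictMono g →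
    0 < (M.submatrix f g).det) ∧
  (∀ (k : ℕ) (f : Fin (k + 1) → Fin r) (g : Fin k → Fin s), StrictMono f → StrictMono g →
    ∀ a, 0 < vecDet (fun p => v (f p)) (M.submatrix f g) a)

/-- The matrix `L = diag(λ₁, -λ₂)`. -/
def L (lam : Fin 2 → ℝ) : Matrix (Fin 2) (Fin 2) ℝ := Matrix.diagonal ![lam 0, -lam 1]

end NV2

namespace NV2
open Filter Topology

/-! Away from the masses a solution is `φ₁ = α eʸ - γ e⁻ʸ`, `φ₃ = α eʸ + γ e⁻ʸ`, `φ₂ = β`, so the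
system reduces to transfer equations for `(α, γ, β)` at the two masses. Solving them gives explicit
`A` (quadratic, `A(0) = 1`) and `B` (linear). Decay at both ends makes the eigenvalues exactly the
zeros of `A(-z²)`.

Write `p = exp (x 0)`, `q = exp (x 1)`, `μ = λ₁⁻¹`, `ν = λ₂⁻¹`, `b = b₁`, `c = b₂`. Comparing
coefficients turns the spectral data into four equations (`hasSpectralData_iff`). They force `q m₂ =
s (b + c)` and `p m₁ = μ b + ν c - s (b + c)`, where `s = ⟨m₂, m₂⟩` is determined by `μ, ν, b, c`.
Conversely, once this second vector is positive, positions `x 0 < x 1` and positive masses can be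
recovered (`exists_mass_iff`). Each of its components is a positive factor times one of `ν b₁c₀ - μ
b₀c₁`, `ν b₀c₁ - μ b₁c₀` (components numbered 0 and 1), by `residual_fst` and `residual_snd`. Hence
membership in `𝒮(2)` amounts to two inequalities (`mem_spectralData_iff`).

The other three conditions say the same: the two pairings with `L` are these differences up to the
factor `λ₁λ₂`, and the components of `G` and the order-two minors of `Λ₂(2)` are positive multiples
of one of them or of their product. -/

/-! ### Free solutions between masses and the jump conditions. -/

/-- The functions `(f + g) e⁻ʸ` and `(g - f) eʸ` have zero derivative, hence are constant on a
preconnected open set. -/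
lemma exists_exp_form {f g : ℝ → ℂ} {s : Set ℝ} (hs : IsOpen s) (hc : IsPreconnected s)
    (hf : ∀ y ∈ s, HasDerivAt f (g y) y) (hg : ∀ y ∈ s, HasDerivAt g (f y) y) :
    ∃ α γ : ℂ, ∀ y ∈ s, f y = α * Complex.exp y - γ * Complex.exp (-y) ∧
      g y = α * Complex.exp y + γ * Complex.exp (-y) := by
  have hE : ∀ y : ℝ, HasDerivAt (fun y : ℝ => Complex.exp y) (Complex.exp y) y := fun y =>
    (Complex.hasDerivAt_exp y).comp_ofReal
  have hE' : ∀ y : ℝ, HasDerivAt (fun y : ℝ => Complex.exp (-y)) (-Complex.exp (-y)) y := fun y => by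
    simpa using ((hasDerivAt_neg (y : ℂ)).cexp).comp_ofReal
  have h1 : ∀ y ∈ s, HasDerivAt (fun y => (f y + g y) * Complex.exp (-y)) 0 y := fun y hy => by
    have := ((hf y hy).add (hg y hy)).mul (hE' y)
    refine this.congr_deriv ?_; simp only [Pi.add_apply]; ring
  have h2 : ∀ y ∈ s, HasDerivAt (fun y => (g y - f y) * Complex.exp y) 0 y := fun y hy => by
    have := ((hg y hy).sub (hf y hy)).mul (hE y)
    refine this.congr_deriv ?_; simp only [Pi.sub_apply]; ring
  obtain ⟨a, ha⟩ := hs.exists_is_const_of_deriv_eq_zero hc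
    (fun y hy => (h1 y hy).differentiableAt.differentiableWithinAt) (fun y hy => (h1 y hy).deriv)
  obtain ⟨c, hc⟩ := hs.exists_is_const_of_deriv_eq_zero hc
    (fun y hy => (h2 y hy).differentiableAt.differentiableWithinAt) (fun y hy => (h2 y hy).deriv)
  refine ⟨a / 2, c / 2, fun y hy => ?_⟩
  have e : Complex.exp y * Complex.exp (-y) = 1 := by rw [← Complex.exp_add]; simp
  rw [← ha y hy, ← hc y hy]
  constructor
  · linear_combination (-f y) * e
  · linear_combination (-g y) * e

/-- On the filter `l`, `φ` has the form of a solution of the system without masses. -/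
def FreeOn (l : Filter ℝ) (φ₁ : ℝ → ℂ) (φ₂ : ℝ → Fin 2 → ℂ) (φ₃ : ℝ → ℂ)
    (α γ : ℂ) (β : Fin 2 → ℂ) : Prop :=
  ∀ᶠ y in l, φ₁ y = α * Complex.exp y - γ * Complex.exp (-y) ∧ φ₂ y = β ∧
    φ₃ y = α * Complex.exp y + γ * Complex.exp (-y)

lemma FreeOn.filter_mono {l l' : Filter ℝ} {φ₁ : ℝ → ℂ} {φ₂ : ℝ → Fin 2 → ℂ} {φ₃ : ℝ → ℂ}
    {α γ : ℂ} {β : Fin 2 → ℂ} (h : FreeOn l φ₁ φ₂ φ₃ α γ β) (hl : l' ≤ l) :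
    FreeOn l' φ₁ φ₂ φ₃ α γ β :=
  Eventually.filter_mono hl h

lemma tendsto_exp_sub (l : Filter ℝ) (ξ : ℝ) (hl : l ≤ 𝓝 ξ) (α γ : ℂ) :
    Tendsto (fun y : ℝ => α * Complex.exp y - γ * Complex.exp (-y)) l
      (𝓝 (α * Complex.exp ξ - γ * Complex.exp (-ξ))) := by
  have : Continuous (fun y : ℝ => α * Complex.exp y - γ * Complex.exp (-y)) := by fun_prop
  exact (this.tendsto ξ).mono_left hl

lemma tendsto_exp_add (l : Filter ℝ) (ξ : ℝ) (hl : l ≤ 𝓝 ξ) (α γ : ℂ) :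
    Tendsto (fun y : ℝ => α * Complex.exp y + γ * Complex.exp (-y)) l
      (𝓝 (α * Complex.exp ξ + γ * Complex.exp (-ξ))) := by
  have : Continuous (fun y : ℝ => α * Complex.exp y + γ * Complex.exp (-y)) := by fun_prop
  exact (this.tendsto ξ).mono_left hl

lemma FreeOn.tendsto {l : Filter ℝ} {φ₁ : ℝ → ℂ} {φ₂ : ℝ → Fin 2 → ℂ} {φ₃ : ℝ → ℂ}
    {α γ : ℂ} {β : Fin 2 → ℂ} (h : FreeOn l φ₁ φ₂ φ₃ α γ β) {ξ : ℝ} (hl : l ≤ 𝓝 ξ) :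
    Tendsto φ₁ l (𝓝 (α * Complex.exp ξ - γ * Complex.exp (-ξ))) ∧ Tendsto φ₂ l (𝓝 β) ∧
      Tendsto φ₃ l (𝓝 (α * Complex.exp ξ + γ * Complex.exp (-ξ))) := by
  refine ⟨(tendsto_exp_sub l ξ hl α γ).congr' ?_, tendsto_const_nhds.congr' ?_,
    (tendsto_exp_add l ξ hl α γ).congr' ?_⟩ <;>
  filter_upwards [h] with y hy
  exacts [hy.1.symm, hy.2.1.symm, hy.2.2.symm]

/-- By uniqueness of limits the one-sided limits in the jump conditions are those of the free forms,
so the conditions become algebraic equations in the coefficients. -/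
lemma IsLaxSolution.jump {N : ℕ} {x : Fin N → ℝ} {m : Fin N → Fin 2 → ℝ} {z : ℂ}
    {φ₁ : ℝ → ℂ} {φ₂ : ℝ → Fin 2 → ℂ} {φ₃ : ℝ → ℂ} (h : IsLaxSolution x m z φ₁ φ₂ φ₃) (k : Fin N)
    {α γ α' γ' : ℂ} {β β' : Fin 2 → ℂ} (hl : FreeOn (𝓝[<] x k) φ₁ φ₂ φ₃ α γ β)
    (hr : FreeOn (𝓝[>] x k) φ₁ φ₂ φ₃ α' γ' β') :
    φ₃ (x k) = α * Complex.exp (x k) + γ * Complex.exp (-x k) ∧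
    φ₃ (x k) = α' * Complex.exp (x k) + γ' * Complex.exp (-x k) ∧
    (∀ a, φ₂ (x k) a = (β a + β' a) / 2) ∧
    φ₁ (x k) = ((α * Complex.exp (x k) - γ * Complex.exp (-x k)) +
      (α' * Complex.exp (x k) - γ' * Complex.exp (-x k))) / 2 ∧
    (∀ a, β' a = β a + 2 * z * φ₃ (x k) * m k a) ∧
    (α' * Complex.exp (x k) - γ' * Complex.exp (-x k)) -
      (α * Complex.exp (x k) - γ * Complex.exp (-x k)) =
      2 * z * pairing (fun a => (m k a : ℂ)) (φ₂ (x k)) := by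
  obtain ⟨l1, l2, l3⟩ := hl.tendsto nhdsWithin_le_nhds
  obtain ⟨r1, r2, r3⟩ := hr.tendsto nhdsWithin_le_nhds
  obtain ⟨l, r, jl, jr, jv, jj⟩ := h.jump₁ k
  obtain ⟨l', r', jl', jr', jv', jj'⟩ := h.jump₂ k
  obtain rfl := tendsto_nhds_unique jl l1
  obtain rfl := tendsto_nhds_unique jr r1
  obtain rfl := tendsto_nhds_unique jl' l2
  obtain rfl := tendsto_nhds_unique jr' r2
  have c3 := h.continuous₃.tendsto (x k)
  exact ⟨tendsto_nhds_unique (c3.mono_left nhdsWithin_le_nhds) l3,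
    tendsto_nhds_unique (c3.mono_left nhdsWithin_le_nhds) r3, jv', jv,
    fun a => by linear_combination jj' a, jj⟩

lemma IsLaxSolution.exists_free {N : ℕ} {x : Fin N → ℝ} {m : Fin N → Fin 2 → ℝ} {z : ℂ}
    {φ₁ : ℝ → ℂ} {φ₂ : ℝ → Fin 2 → ℂ} {φ₃ : ℝ → ℂ} (h : IsLaxSolution x m z φ₁ φ₂ φ₃)
    {s : Set ℝ} (hs : IsOpen s) (hc : IsPreconnected s) (hx : ∀ y ∈ s, ∀ k, y ≠ x k) :
    ∃ (α γ : ℂ) (β : Fin 2 → ℂ), FreeOn (𝓟 s) φ₁ φ₂ φ₃ α γ β := by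
  obtain ⟨α, γ, hαγ⟩ := exists_exp_form hs hc (fun y hy => h.deriv₁ y (hx y hy))
    (fun y hy => h.deriv₃ y (hx y hy))
  obtain ⟨β, hβ⟩ := hs.exists_is_const_of_deriv_eq_zero hc
    (fun y hy => (h.deriv₂ y (hx y hy)).differentiableAt.differentiableWithinAt)
    (fun y hy => (h.deriv₂ y (hx y hy)).deriv)
  exact ⟨α, γ, β, fun y hy => ⟨(hαγ y hy).1, hβ y hy, (hαγ y hy).2⟩⟩

/-! ### The scattering polynomials and the transfer across both masses. -/

/-- The coefficient of `-λ` in `A(λ)`. -/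
noncomputable def coeffOne (x : Fin 2 → ℝ) (m : Fin 2 → Fin 2 → ℝ) : ℝ :=
  pairing (m 0) (m 0) + pairing (m 1) (m 1) +
    2 * (Real.exp (x 0) * Real.exp (-x 1)) * pairing (m 0) (m 1)

/-- The coefficient of `λ²` in `A(λ)`. -/
noncomputable def coeffTwo (x : Fin 2 → ℝ) (m : Fin 2 → Fin 2 → ℝ) : ℝ :=
  pairing (m 0) (m 0) * pairing (m 1) (m 1) * (1 - (Real.exp (x 0) * Real.exp (-x 1)) ^ 2)

/-- Minus the slope in `λ` of the value of `φ₃` at the second mass. -/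
noncomputable def slope (x : Fin 2 → ℝ) (m : Fin 2 → Fin 2 → ℝ) : ℝ :=
  pairing (m 0) (m 0) * (Real.exp (x 1) - Real.exp (x 0) ^ 2 * Real.exp (-x 1))

/-- The value of `φ₃` at the second mass, as a polynomial in `λ`. -/
noncomputable def polyF (x : Fin 2 → ℝ) (m : Fin 2 → Fin 2 → ℝ) : ℂ[X] :=
  Polynomial.C (Real.exp (x 1) : ℂ) - Polynomial.C (slope x m : ℂ) * Polynomial.X

/-- The polynomial `A`. -/
noncomputable def polyA (x : Fin 2 → ℝ) (m : Fin 2 → Fin 2 → ℝ) : ℂ[X] :=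
  1 - Polynomial.C (coeffOne x m : ℂ) * Polynomial.X +
    Polynomial.C (coeffTwo x m : ℂ) * Polynomial.X ^ 2

/-- The polynomials `B`. -/
noncomputable def polyB (x : Fin 2 → ℝ) (m : Fin 2 → Fin 2 → ℝ) (a : Fin 2) : ℂ[X] :=
  Polynomial.C (Real.exp (x 0) * m 0 a : ℂ) + Polynomial.C (m 1 a : ℂ) * polyF x m

/-- The polynomial `C`. -/
noncomputable def polyC (x : Fin 2 → ℝ) (m : Fin 2 → Fin 2 → ℝ) : ℂ[X] :=
  Polynomial.C (pairing (m 0) (m 0) * Real.exp (x 0) ^ 2 +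
    2 * Real.exp (x 0) * Real.exp (x 1) * pairing (m 0) (m 1) : ℂ) +
    Polynomial.C (Real.exp (x 1) * pairing (m 1) (m 1) : ℂ) * polyF x m

lemma eval_polyF (x : Fin 2 → ℝ) (m : Fin 2 → Fin 2 → ℝ) (ζ : ℂ) :
    (polyF x m).eval ζ = Real.exp (x 1) - slope x m * ζ := by simp [polyF]

lemma eval_polyA (x : Fin 2 → ℝ) (m : Fin 2 → Fin 2 → ℝ) (ζ : ℂ) :
    (polyA x m).eval ζ = 1 - coeffOne x m * ζ + coeffTwo x m * ζ ^ 2 := by simp [polyA]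

lemma eval_polyB (x : Fin 2 → ℝ) (m : Fin 2 → Fin 2 → ℝ) (a : Fin 2) (ζ : ℂ) :
    (polyB x m a).eval ζ =
      Real.exp (x 0) * m 0 a + m 1 a * (Real.exp (x 1) - slope x m * ζ) := by
  simp [polyB, eval_polyF]

lemma eval_polyC (x : Fin 2 → ℝ) (m : Fin 2 → Fin 2 → ℝ) (ζ : ℂ) :
    (polyC x m).eval ζ = pairing (m 0) (m 0) * Real.exp (x 0) ^ 2 +
      2 * Real.exp (x 0) * Real.exp (x 1) * pairing (m 0) (m 1) +
      Real.exp (x 1) * pairing (m 1) (m 1) * (Real.exp (x 1) - slope x m * ζ) := by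
  simp [polyC, eval_polyF]

lemma exp_mul_exp_neg (y : ℝ) : Complex.exp y * Complex.exp (-y) = 1 := by
  rw [← Complex.exp_add]; simp

/-- A solution with `φ₁ = φ₃ = c eʸ`, `φ₂ = 0` on the left. -/
lemma IsLaxSolution.propagate {x : Fin 2 → ℝ} {m : Fin 2 → Fin 2 → ℝ} {z : ℂ}
    {φ₁ : ℝ → ℂ} {φ₂ : ℝ → Fin 2 → ℂ} {φ₃ : ℝ → ℂ} (h : IsLaxSolution x m z φ₁ φ₂ φ₃)
    (hx : x 0 < x 1) {c : ℂ} (hl : FreeOn (𝓟 (Set.Iio (x 0))) φ₁ φ₂ φ₃ c 0 0) :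
    (∀ y, x 1 < y → φ₁ y + φ₃ y = 2 * (c * (polyA x m).eval (-z ^ 2)) * Complex.exp y ∧
      (∀ a, φ₂ y a = 2 * z * (c * (polyB x m a).eval (-z ^ 2)))) ∧
    (c = 0 → φ₁ = 0 ∧ φ₂ = 0 ∧ φ₃ = 0) := by
  obtain ⟨α, γ, β, hm⟩ := h.exists_free (s := Set.Ioo (x 0) (x 1)) isOpen_Ioo isPreconnected_Ioo
    (fun y hy k => by fin_cases k <;> [exact hy.1.ne'; exact hy.2.ne])
  obtain ⟨α', γ', β', hr⟩ := h.exists_free (s := Set.Ioi (x 1)) isOpen_Ioi isPreconnected_Ioi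
    (fun y hy k => by fin_cases k <;> [exact (hx.trans hy).ne'; exact (Set.mem_Ioi.1 hy).ne'])
  obtain ⟨f1, f2, f3, f4, f5, f6⟩ := h.jump 0 (hl.filter_mono (le_principal_iff.2 self_mem_nhdsWithin))
    (hm.filter_mono (le_principal_iff.2 (Ioo_mem_nhdsGT hx)))
  obtain ⟨g1, g2, g3, g4, g5, g6⟩ := h.jump 1
    (hm.filter_mono (le_principal_iff.2 (Ioo_mem_nhdsLT hx)))
    (hr.filter_mono (le_principal_iff.2 self_mem_nhdsWithin))
  have ep := exp_mul_exp_neg (x 0)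
  have eq := exp_mul_exp_neg (x 1)
  simp only [pairing, f3, g3, f5, g5, Pi.zero_apply] at f6 g6
  rw [f1] at f2 f5
  rw [g1] at g2 g5
  simp only [f1, g1] at f6 g6
  simp only [f5, Pi.zero_apply] at g5 g6
  -- From here on `e^{±x_k}` are free variables, related only by `ep` and `eq`.
  generalize hp : Complex.exp (x 0) = p at *
  generalize hp' : Complex.exp (-x 0) = p' at *
  generalize hq : Complex.exp (x 1) = q at *
  generalize hq' : Complex.exp (-x 1) = q' at *
  -- Adding the jump of `φ₁` to the zero jump of `φ₃` isolates `α`. The averaged `φ₂` contributes `z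
  -- φ₃ m`, whence the term with `⟨m, m⟩ = 2 m₀ m₁`.
  have hα : α = c * (1 + z ^ 2 * (2 * m 0 0 * m 0 1)) := by
    linear_combination (p' / 2) * f6 - (p' / 2) * f2 - (α - c - c * z ^ 2 * (2 * m 0 0 * m 0 1)) * ep
  have hγ : γ = - c * z ^ 2 * (2 * m 0 0 * m 0 1) * p ^ 2 := by
    subst hα
    linear_combination (-p) * f2 - γ * ep
  subst hα hγ
  have hα' : α' = c * (1 - coeffOne x m * (-z ^ 2) + coeffTwo x m * (-z ^ 2) ^ 2) := by
    simp only [coeffOne, coeffTwo, pairing]; push_cast; rw [hp, hq']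
    linear_combination (q' / 2) * g6 - (q' / 2) * g2 -
      (α' - c * (1 + z ^ 2 * (2 * m 0 0 * m 0 1)) -
        c * (1 + z ^ 2 * (2 * m 0 0 * m 0 1)) * z ^ 2 * (2 * m 1 0 * m 1 1)) * eq
  constructor
  · intro y hy
    obtain ⟨k1, k2, k3⟩ := hr hy
    refine ⟨?_, fun a => ?_⟩
    · rw [k1, k3, eval_polyA, hα']; ring
    · rw [k2, eval_polyB, g5]; simp only [slope, pairing]; push_cast; rw [hp, hq, hq']; ring
  · rintro rfl
    have hα0 : α' = 0 := by simpa using hα'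
    have hγ0 : γ' = 0 := by
      subst hα0
      linear_combination (-q) * g2 - γ' * eq
    have hβ0 : β = 0 := by ext a; simp [f5]
    have hβ0' : β' = 0 := by ext a; simp [g5]
    have key : ∀ y, φ₁ y = 0 ∧ φ₂ y = 0 ∧ φ₃ y = 0 := by
      intro y
      rcases lt_trichotomy y (x 0) with h0 | rfl | h0
      · simpa using hl h0
      · refine ⟨by simp [f4], by ext a; simp [f3, f5], by simp [f1]⟩
      rcases lt_trichotomy y (x 1) with h1 | rfl | h1
      · simpa [hβ0] using hm ⟨h0, h1⟩
      · refine ⟨by simp [g4, hα0, hγ0], by ext a; simp [g3, g5, f5], by simp [g1]⟩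
      · simpa [hβ0', hα0, hγ0] using hr h1
    exact ⟨funext fun y => (key y).1, funext fun y => (key y).2.1, funext fun y => (key y).2.2⟩

/-! ### Building solutions from the jump equations. -/

lemma FreeOn.hasDerivAt {φ₁ : ℝ → ℂ} {φ₂ : ℝ → Fin 2 → ℂ} {φ₃ : ℝ → ℂ}
    {α γ : ℂ} {β : Fin 2 → ℂ} {y : ℝ} (h : FreeOn (𝓝 y) φ₁ φ₂ φ₃ α γ β) :
    HasDerivAt φ₁ (φ₃ y) y ∧ HasDerivAt φ₂ 0 y ∧ HasDerivAt φ₃ (φ₁ y) y := by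
  have hE : HasDerivAt (fun y : ℝ => Complex.exp y) (Complex.exp y) y :=
    (Complex.hasDerivAt_exp y).comp_ofReal
  have hE' : HasDerivAt (fun y : ℝ => Complex.exp (-y)) (-Complex.exp (-y)) y := by
    simpa using ((hasDerivAt_neg (y : ℂ)).cexp).comp_ofReal
  obtain ⟨e1, -, e3⟩ := h.self_of_nhds
  refine ⟨?_, (hasDerivAt_const y β).congr_of_eventuallyEq ?_, ?_⟩
  · have := ((hE.const_mul α).sub (hE'.const_mul γ)).congr_of_eventuallyEq (f₁ := φ₁)
      (h.mono fun _ hy => hy.1)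
    rw [e3]; refine this.congr_deriv ?_; ring
  · exact h.mono fun _ hy => hy.2.1
  · have := ((hE.const_mul α).add (hE'.const_mul γ)).congr_of_eventuallyEq (f₁ := φ₃)
      (h.mono fun _ hy => hy.2.2)
    rw [e1]; refine this.congr_deriv ?_; ring

/-- The disjunction in `hj` lists the coefficients to the left and right of each mass, so that both
masses are handled by one argument. -/
lemma isLaxSolution_of_free {x : Fin 2 → ℝ} {m : Fin 2 → Fin 2 → ℝ} {z : ℂ}
    {φ₁ : ℝ → ℂ} {φ₂ : ℝ → Fin 2 → ℂ} {φ₃ : ℝ → ℂ} (hx : x 0 < x 1)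
    {α₀ γ₀ α₁ γ₁ α₂ γ₂ : ℂ} {β₀ β₁ β₂ : Fin 2 → ℂ}
    (h0 : FreeOn (𝓟 (Set.Iio (x 0))) φ₁ φ₂ φ₃ α₀ γ₀ β₀)
    (h1 : FreeOn (𝓟 (Set.Ioo (x 0) (x 1))) φ₁ φ₂ φ₃ α₁ γ₁ β₁)
    (h2 : FreeOn (𝓟 (Set.Ioi (x 1))) φ₁ φ₂ φ₃ α₂ γ₂ β₂)
    (hj : ∀ k, ∀ α γ α' γ' : ℂ, ∀ β β' : Fin 2 → ℂ,
      ((k = 0 ∧ α = α₀ ∧ γ = γ₀ ∧ β = β₀ ∧ α' = α₁ ∧ γ' = γ₁ ∧ β' = β₁) ∨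
        (k = 1 ∧ α = α₁ ∧ γ = γ₁ ∧ β = β₁ ∧ α' = α₂ ∧ γ' = γ₂ ∧ β' = β₂)) →
      φ₃ (x k) = α * Complex.exp (x k) + γ * Complex.exp (-x k) ∧
      φ₃ (x k) = α' * Complex.exp (x k) + γ' * Complex.exp (-x k) ∧
      (∀ a, φ₂ (x k) a = (β a + β' a) / 2) ∧
      φ₁ (x k) = ((α * Complex.exp (x k) - γ * Complex.exp (-x k)) +
        (α' * Complex.exp (x k) - γ' * Complex.exp (-x k))) / 2 ∧
      (∀ a, β' a - β a = 2 * z * φ₃ (x k) * m k a) ∧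
      (α' * Complex.exp (x k) - γ' * Complex.exp (-x k)) -
        (α * Complex.exp (x k) - γ * Complex.exp (-x k)) =
        2 * z * pairing (fun a => (m k a : ℂ)) (φ₂ (x k))) :
    IsLaxSolution x m z φ₁ φ₂ φ₃ := by
  have hd : ∀ y, (∀ k, y ≠ x k) →
      HasDerivAt φ₁ (φ₃ y) y ∧ HasDerivAt φ₂ 0 y ∧ HasDerivAt φ₃ (φ₁ y) y := by
    intro y hy
    rcases lt_or_gt_of_ne (hy 0) with h | h
    · exact (h0.filter_mono (le_principal_iff.2 (Iio_mem_nhds h))).hasDerivAt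
    rcases lt_or_gt_of_ne (hy 1) with h' | h'
    · exact (h1.filter_mono (le_principal_iff.2 (Ioo_mem_nhds h h'))).hasDerivAt
    · exact (h2.filter_mono (le_principal_iff.2 (Ioi_mem_nhds h'))).hasDerivAt
  have hk : ∀ k, ∃ α γ α' γ' : ℂ, ∃ β β' : Fin 2 → ℂ,
      ((k = 0 ∧ α = α₀ ∧ γ = γ₀ ∧ β = β₀ ∧ α' = α₁ ∧ γ' = γ₁ ∧ β' = β₁) ∨
        (k = 1 ∧ α = α₁ ∧ γ = γ₁ ∧ β = β₁ ∧ α' = α₂ ∧ γ' = γ₂ ∧ β' = β₂)) ∧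
      FreeOn (𝓝[<] x k) φ₁ φ₂ φ₃ α γ β ∧ FreeOn (𝓝[>] x k) φ₁ φ₂ φ₃ α' γ' β' := by
    rw [Fin.forall_fin_two]
    exact ⟨⟨α₀, γ₀, α₁, γ₁, β₀, β₁, by simp,
      h0.filter_mono (le_principal_iff.2 self_mem_nhdsWithin),
      h1.filter_mono (le_principal_iff.2 (Ioo_mem_nhdsGT hx))⟩,
      ⟨α₁, γ₁, α₂, γ₂, β₁, β₂, by simp,
      h1.filter_mono (le_principal_iff.2 (Ioo_mem_nhdsLT hx)),
      h2.filter_mono (le_principal_iff.2 self_mem_nhdsWithin)⟩⟩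
  refine ⟨fun y hy => (hd y hy).1, fun y hy => (hd y hy).2.1, fun y hy => (hd y hy).2.2, ?_, ?_, ?_⟩
  · rw [continuous_iff_continuousAt]
    intro y
    by_cases hy : ∀ k, y ≠ x k
    · exact (hd y hy).2.2.continuousAt
    push Not at hy
    obtain ⟨k, rfl⟩ := hy
    obtain ⟨α, γ, α', γ', β, β', hkk, hl, hr⟩ := hk k
    obtain ⟨e1, e2, -⟩ := hj k _ _ _ _ _ _ hkk
    rw [continuousAt_iff_continuous_left'_right']
    refine ⟨?_, ?_⟩
    · have := (hl.tendsto nhdsWithin_le_nhds).2.2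
      rwa [← e1] at this
    · have := (hr.tendsto nhdsWithin_le_nhds).2.2
      rwa [← e2] at this
  · intro k
    obtain ⟨α, γ, α', γ', β, β', hkk, hl, hr⟩ := hk k
    obtain ⟨-, -, -, e4, -, e6⟩ := hj k _ _ _ _ _ _ hkk
    exact ⟨_, _, (hl.tendsto nhdsWithin_le_nhds).1, (hr.tendsto nhdsWithin_le_nhds).1, e4, e6⟩
  · intro k
    obtain ⟨α, γ, α', γ', β, β', hkk, hl, hr⟩ := hk k
    obtain ⟨-, -, e3, -, e5, -⟩ := hj k _ _ _ _ _ _ hkk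
    exact ⟨_, _, (hl.tendsto nhdsWithin_le_nhds).2.1, (hr.tendsto nhdsWithin_le_nhds).2.1, e3, e5⟩

/-- A function given by three formulas, on the left of `p`, between `p` and `q` and on the right
of `q`, with prescribed values at `p` and `q`. -/
noncomputable def glue {E : Type*} (p q : ℝ) (f₀ f₁ f₂ : ℝ → E) (v w : E) (y : ℝ) : E :=
  if y < p then f₀ y else if y = p then v else if y < q then f₁ y else if y = q then w else f₂ y

section glue
variable {E : Type*} {p q : ℝ} {f₀ f₁ f₂ : ℝ → E} {v w : E} {y : ℝ}

lemma glue_left (h : y < p) : glue p q f₀ f₁ f₂ v w y = f₀ y := by simp [glue, h]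

lemma glue_mid (h : p < y) (h' : y < q) : glue p q f₀ f₁ f₂ v w y = f₁ y := by
  simp [glue, h.ne', h.not_gt, h']

lemma glue_right (hpq : p < q) (h : q < y) : glue p q f₀ f₁ f₂ v w y = f₂ y := by
  simp [glue, (hpq.trans h).ne', (hpq.trans h).not_gt, h.ne', h.not_gt]

lemma glue_fst : glue p q f₀ f₁ f₂ v w p = v := by simp [glue]

lemma glue_snd (hpq : p < q) : glue p q f₀ f₁ f₂ v w q = w := by
  simp [glue, hpq.ne', hpq.not_gt]

end glue

lemma exists_isLaxSolution_of_jump {x : Fin 2 → ℝ} {m : Fin 2 → Fin 2 → ℝ} {z : ℂ} (hx : x 0 < x 1)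
    {α₀ γ₀ α₁ γ₁ α₂ γ₂ : ℂ} {β₀ β₁ β₂ : Fin 2 → ℂ}
    (c0 : α₀ * Complex.exp (x 0) + γ₀ * Complex.exp (-x 0) =
      α₁ * Complex.exp (x 0) + γ₁ * Complex.exp (-x 0))
    (c1 : α₁ * Complex.exp (x 1) + γ₁ * Complex.exp (-x 1) =
      α₂ * Complex.exp (x 1) + γ₂ * Complex.exp (-x 1))
    (b0 : ∀ a, β₁ a - β₀ a =
      2 * z * (α₀ * Complex.exp (x 0) + γ₀ * Complex.exp (-x 0)) * m 0 a)
    (b1 : ∀ a, β₂ a - β₁ a =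
      2 * z * (α₁ * Complex.exp (x 1) + γ₁ * Complex.exp (-x 1)) * m 1 a)
    (d0 : (α₁ * Complex.exp (x 0) - γ₁ * Complex.exp (-x 0)) -
        (α₀ * Complex.exp (x 0) - γ₀ * Complex.exp (-x 0)) =
        2 * z * pairing (fun a => (m 0 a : ℂ)) (fun a => (β₀ a + β₁ a) / 2))
    (d1 : (α₂ * Complex.exp (x 1) - γ₂ * Complex.exp (-x 1)) -
        (α₁ * Complex.exp (x 1) - γ₁ * Complex.exp (-x 1)) =
        2 * z * pairing (fun a => (m 1 a : ℂ)) (fun a => (β₁ a + β₂ a) / 2)) :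
    ∃ φ₁ φ₂ φ₃, IsLaxSolution x m z φ₁ φ₂ φ₃ ∧
      FreeOn (𝓟 (Set.Iio (x 0))) φ₁ φ₂ φ₃ α₀ γ₀ β₀ ∧
      FreeOn (𝓟 (Set.Ioi (x 1))) φ₁ φ₂ φ₃ α₂ γ₂ β₂ := by
  let f : ℂ → ℂ → ℝ → ℂ := fun α γ y => α * Complex.exp y - γ * Complex.exp (-y)
  let g : ℂ → ℂ → ℝ → ℂ := fun α γ y => α * Complex.exp y + γ * Complex.exp (-y)
  let φ₁ : ℝ → ℂ := glue (x 0) (x 1) (f α₀ γ₀) (f α₁ γ₁) (f α₂ γ₂)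
    ((f α₀ γ₀ (x 0) + f α₁ γ₁ (x 0)) / 2) ((f α₁ γ₁ (x 1) + f α₂ γ₂ (x 1)) / 2)
  let φ₂ : ℝ → Fin 2 → ℂ := glue (x 0) (x 1) (fun _ => β₀) (fun _ => β₁) (fun _ => β₂)
    (fun a => (β₀ a + β₁ a) / 2) (fun a => (β₁ a + β₂ a) / 2)
  let φ₃ : ℝ → ℂ := glue (x 0) (x 1) (g α₀ γ₀) (g α₁ γ₁) (g α₂ γ₂)
    (g α₀ γ₀ (x 0)) (g α₁ γ₁ (x 1))
  have h0 : FreeOn (𝓟 (Set.Iio (x 0))) φ₁ φ₂ φ₃ α₀ γ₀ β₀ := fun y hy =>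
    ⟨glue_left hy, glue_left hy, glue_left hy⟩
  have h1 : FreeOn (𝓟 (Set.Ioo (x 0) (x 1))) φ₁ φ₂ φ₃ α₁ γ₁ β₁ := fun y hy =>
    ⟨glue_mid hy.1 hy.2, glue_mid hy.1 hy.2, glue_mid hy.1 hy.2⟩
  have h2 : FreeOn (𝓟 (Set.Ioi (x 1))) φ₁ φ₂ φ₃ α₂ γ₂ β₂ := fun y hy =>
    ⟨glue_right hx hy, glue_right hx hy, glue_right hx hy⟩
  have v1 : φ₁ (x 0) = _ := glue_fst
  have v2 : φ₂ (x 0) = _ := glue_fst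
  have v3 : φ₃ (x 0) = _ := glue_fst
  have w1 : φ₁ (x 1) = _ := glue_snd hx
  have w2 : φ₂ (x 1) = _ := glue_snd hx
  have w3 : φ₃ (x 1) = _ := glue_snd hx
  refine ⟨φ₁, φ₂, φ₃, isLaxSolution_of_free hx h0 h1 h2 ?_, h0, h2⟩
  rintro k α γ α' γ' β β' (⟨rfl, rfl, rfl, rfl, rfl, rfl, rfl⟩ | ⟨rfl, rfl, rfl, rfl, rfl, rfl, rfl⟩)
  · rw [v1, v2, v3]
    exact ⟨rfl, c0, fun a => rfl, rfl, b0, d0⟩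
  · rw [w1, w2, w3]
    exact ⟨rfl, c1, fun a => rfl, rfl, b1, d1⟩

lemma exists_isLaxSolution {x : Fin 2 → ℝ} (m : Fin 2 → Fin 2 → ℝ) (z : ℂ) (hx : x 0 < x 1) :
    ∃ φ₁ φ₂ φ₃, IsLaxSolution x m z φ₁ φ₂ φ₃ ∧
      FreeOn (𝓟 (Set.Iio (x 0))) φ₁ φ₂ φ₃ 1 0 0 ∧
      FreeOn (𝓟 (Set.Ioi (x 1))) φ₁ φ₂ φ₃ ((polyA x m).eval (-z ^ 2))
        (-z ^ 2 * (polyC x m).eval (-z ^ 2))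
        (fun a => 2 * z * (polyB x m a).eval (-z ^ 2)) := by
  have ep := exp_mul_exp_neg (x 0)
  have eq := exp_mul_exp_neg (x 1)
  -- The middle coefficients solve the jump equations at `x 0` for the incoming data `(1, 0, 0)`.
  refine exists_isLaxSolution_of_jump hx (α₁ := 1 + z ^ 2 * (2 * m 0 0 * m 0 1))
    (γ₁ := - z ^ 2 * (2 * m 0 0 * m 0 1) * Complex.exp (x 0) ^ 2)
    (β₁ := fun a => 2 * z * Complex.exp (x 0) * m 0 a) ?_ ?_ ?_ ?_ ?_ ?_ <;>
  (try simp only [eval_polyA, eval_polyB, eval_polyC, coeffOne, coeffTwo, slope, pairing,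
    Pi.zero_apply]) <;>
  push_cast <;>
  generalize Complex.exp (x 0) = p at * <;>
  generalize Complex.exp (-x 0) = p' at * <;>
  generalize Complex.exp (x 1) = q at * <;>
  generalize Complex.exp (-x 1) = q' at *
  · linear_combination (z ^ 2 * (2 * m 0 0 * m 0 1) * p) * ep
  · linear_combination (z ^ 2 * q * (2 * m 1 0 * m 1 1) * (1 + z ^ 2 * (2 * m 0 0 * m 0 1))) * eq
  · intro a; ring
  · intro a; ring
  · linear_combination (z ^ 2 * (2 * m 0 0 * m 0 1) * p) * ep
  · linear_combination (4 * z ^ 2 * p * (m 0 0 * m 1 1 + m 0 1 * m 1 0) + z ^ 2 * q * (2 * m 1 0 * m 1 1) +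
      z ^ 4 * (2 * m 0 0 * m 0 1) * (2 * m 1 0 * m 1 1) * (q - 2 * p ^ 2 * q')) * eq

lemma isScattering_poly {x : Fin 2 → ℝ} (m : Fin 2 → Fin 2 → ℝ) (hx : x 0 < x 1) :
    IsScattering x m (polyA x m) (polyB x m) (polyC x m) := by
  intro z
  obtain ⟨φ₁, φ₂, φ₃, h, hl, hr⟩ := exists_isLaxSolution m z hx
  refine ⟨φ₁, φ₂, φ₃, h, fun y hy => ?_, fun y hy => ?_⟩
  · simpa using hl (hy 0)
  · obtain ⟨e1, e2, e3⟩ := hr (hy 1)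
    exact ⟨e1, fun a => by rw [e2], e3⟩

/-! ### Uniqueness of `A`, `B` and the eigenvalues. -/

/-- Spectral data only assert that some `A`, `B`, `C` exist, so these must be identified with the
explicit ones. At `z = 0` the relation `φ₂ = 2 z B` says nothing about `B`, hence `ζ ≠ 0`. -/
lemma IsScattering.eval_eq {x : Fin 2 → ℝ} {m : Fin 2 → Fin 2 → ℝ} (hx : x 0 < x 1)
    {A : ℂ[X]} {B : Fin 2 → ℂ[X]} {C : ℂ[X]} (h : IsScattering x m A B C) {ζ : ℂ} (hζ : ζ ≠ 0) :
    A.eval ζ = (polyA x m).eval ζ ∧ ∀ a, (B a).eval ζ = (polyB x m a).eval ζ := by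
  obtain ⟨z, hz⟩ := IsAlgClosed.exists_pow_nat_eq (-ζ) (n := 2) (by norm_num)
  have hz' : ζ = -z ^ 2 := by rw [hz]; ring
  have hz0 : z ≠ 0 := by rintro rfl; simp [hz'] at hζ
  obtain ⟨φ₁, φ₂, φ₃, hs, hl, hr⟩ := h z
  obtain ⟨hp, -⟩ := hs.propagate hx (c := 1) (fun y hy => by
    simpa using hl y (Fin.forall_fin_two.2 ⟨hy, lt_trans hy hx⟩))
  have hy : x 1 < x 1 + 1 := by linarith
  obtain ⟨e1, e2, e3⟩ := hr (x 1 + 1) (Fin.forall_fin_two.2 ⟨hx.trans hy, hy⟩)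
  obtain ⟨p1, p2⟩ := hp _ hy
  rw [hz']
  refine ⟨?_, fun a => ?_⟩
  · rw [e1, e3] at p1
    have := Complex.exp_ne_zero ((x 1 + 1 : ℝ) : ℂ)
    apply mul_right_cancel₀ this
    linear_combination p1 / 2
  · have := (e2 a).symm.trans (p2 a)
    rw [one_mul] at this
    exact mul_left_cancel₀ (mul_ne_zero two_ne_zero hz0) this

lemma tendsto_ofReal_exp_atBot : Tendsto (fun y : ℝ => Complex.exp y) atBot (𝓝 0) := by
  have := (Complex.continuous_ofReal.tendsto 0).comp Real.tendsto_exp_atBot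
  simpa [Function.comp_def] using this

lemma tendsto_ofReal_exp_neg_atTop : Tendsto (fun y : ℝ => Complex.exp (-y)) atTop (𝓝 0) := by
  have := tendsto_ofReal_exp_atBot.comp tendsto_neg_atTop_atBot
  simpa [Function.comp_def] using this

/-- Decay at `-∞` leaves a nonzero multiple of the normalized solution; decay at `+∞` then kills its
growing coefficient, a multiple of `A(-z²)`. -/
lemma isEigenvalue_iff {x : Fin 2 → ℝ} {m : Fin 2 → Fin 2 → ℝ} (hx : x 0 < x 1) (z : ℂ) :
    IsEigenvalue x m z ↔ (polyA x m).eval (-z ^ 2) = 0 := by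
  have hee : ∀ y : ℝ, Complex.exp y * Complex.exp (-y) = 1 := exp_mul_exp_neg
  constructor
  · rintro ⟨φ₁, φ₂, φ₃, h, hne, t3, t2, t3'⟩
    obtain ⟨α, γ, β, hl⟩ := h.exists_free (s := Set.Iio (x 0)) isOpen_Iio isPreconnected_Iio
      (fun y hy k => by fin_cases k <;>
        [exact (Set.mem_Iio.1 hy).ne; exact ((Set.mem_Iio.1 hy).trans hx).ne])
    have hbot : FreeOn atBot φ₁ φ₂ φ₃ α γ β :=
      hl.filter_mono (le_principal_iff.2 (Iio_mem_atBot _))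
    have hβ : β = 0 := by
      refine tendsto_nhds_unique (tendsto_const_nhds.congr' ?_) t2
      exact hbot.mono fun y hy => hy.2.1.symm
    have hγ : γ = 0 := by
      -- Here `φ₃ eʸ - α e²ʸ` is eventually the constant `γ` and tends to zero.
      have t := (t3.mul tendsto_ofReal_exp_atBot).sub
        ((tendsto_ofReal_exp_atBot.mul tendsto_ofReal_exp_atBot).const_mul α)
      simp only [mul_zero, sub_zero] at t
      refine tendsto_nhds_unique (tendsto_const_nhds.congr' ?_) t
      refine hbot.mono fun y hy => ?_
      simp only [hy.2.2]; linear_combination (-γ) * hee y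
    subst hβ hγ
    obtain ⟨hp, hz⟩ := h.propagate hx hl
    have hα : α ≠ 0 := by
      intro h0
      obtain ⟨a, b, c⟩ := hz h0
      simp [a, b, c] at hne
    obtain ⟨α', γ', β', hr⟩ := h.exists_free (s := Set.Ioi (x 1)) isOpen_Ioi isPreconnected_Ioi
      (fun y hy k => by fin_cases k <;>
        [exact (hx.trans hy).ne'; exact (Set.mem_Ioi.1 hy).ne'])
    have htop : FreeOn atTop φ₁ φ₂ φ₃ α' γ' β' :=
      hr.filter_mono (le_principal_iff.2 (Ioi_mem_atTop _))
    have hα' : α' = 0 := by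
      have t := (t3'.mul tendsto_ofReal_exp_neg_atTop).sub
        ((tendsto_ofReal_exp_neg_atTop.mul tendsto_ofReal_exp_neg_atTop).const_mul γ')
      simp only [mul_zero, sub_zero] at t
      refine tendsto_nhds_unique (tendsto_const_nhds.congr' ?_) t
      refine htop.mono fun y hy => ?_
      simp only [hy.2.2]; linear_combination (-α') * hee y
    subst hα'
    have hy : x 1 < x 1 + 1 := by linarith
    obtain ⟨p1, -⟩ := hp _ hy
    obtain ⟨e1, -, e3⟩ := hr (a := x 1 + 1) hy
    rw [e1, e3] at p1
    have h3 : 2 * (α * (polyA x m).eval (-z ^ 2)) * Complex.exp ((x 1 + 1 : ℝ) : ℂ) = 0 := by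
      rw [← p1]; ring
    simpa [hα, Complex.exp_ne_zero] using h3
  · intro hA
    obtain ⟨φ₁, φ₂, φ₃, h, hl, hr⟩ := exists_isLaxSolution m z hx
    rw [hA] at hr
    refine ⟨φ₁, φ₂, φ₃, h, Or.inl ?_, ?_, ?_, ?_⟩
    · intro h0
      have := (hl (a := x 0 - 1) (by simp)).1
      rw [h0] at this
      simp at this
      exact Complex.exp_ne_zero _ this.symm
    · refine tendsto_ofReal_exp_atBot.congr' ?_
      filter_upwards [Iio_mem_atBot (x 0)] with y hy
      simp [(hl hy).2.2]
    · refine tendsto_const_nhds.congr' ?_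
      filter_upwards [Iio_mem_atBot (x 0)] with y hy
      simp [(hl hy).2.1]
    · have := tendsto_ofReal_exp_neg_atTop.const_mul (-z ^ 2 * (polyC x m).eval (-z ^ 2))
      rw [mul_zero] at this
      refine this.congr' ?_
      filter_upwards [Ioi_mem_atTop (x 1)] with y hy
      simp [(hr hy).2.2]

/-! ### Spectral data as four algebraic equations. -/

/-- Since `A(0) = 1`, the roots fix `A = (λ - λ₁)(λ - λ₂) / (λ₁λ₂)`. The last two equations compare
the constant and linear coefficients of `B` with the partial fractions. -/
lemma hasSpectralData_iff {x : Fin 2 → ℝ} {m : Fin 2 → Fin 2 → ℝ} {lam : Fin 2 → ℝ}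
    {b : Fin 2 → Fin 2 → ℝ} (hx : x 0 < x 1) (hlam : StrictAnti lam) (hpos : ∀ k, 0 < lam k) :
    HasSpectralData x m lam b ↔
      coeffTwo x m = (lam 0)⁻¹ * (lam 1)⁻¹ ∧ coeffOne x m = (lam 0)⁻¹ + (lam 1)⁻¹ ∧
      (∀ a, Real.exp (x 0) * m 0 a + Real.exp (x 1) * m 1 a =
        (lam 0)⁻¹ * b 0 a + (lam 1)⁻¹ * b 1 a) ∧
      ∀ a, slope x m * m 1 a = (lam 0)⁻¹ * (lam 1)⁻¹ * (b 0 a + b 1 a) := by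
  have h0 := hpos 0
  have h1 := hpos 1
  have h01 : lam 1 < lam 0 := hlam (by simp)
  constructor
  · rintro ⟨-, hspec, A, B, C, hS, hW⟩
    have hroot : ∀ k, 1 - coeffOne x m * lam k + coeffTwo x m * lam k ^ 2 = 0 := by
      intro k
      have : (lam k : ℂ) ∈ Set.range (fun k => (lam k : ℂ)) := ⟨k, rfl⟩
      rw [← hspec] at this
      obtain ⟨z, hz, hzk⟩ := this
      rw [isEigenvalue_iff hx, ← hzk, eval_polyA] at hz
      exact_mod_cast hz
    have r0 := hroot 0
    have r1 := hroot 1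
    have e1 : coeffOne x m = coeffTwo x m * (lam 0 + lam 1) := by
      apply mul_left_cancel₀ (sub_pos.2 h01).ne'
      linear_combination r1 - r0
    have e2 : coeffTwo x m = (lam 0)⁻¹ * (lam 1)⁻¹ := by
      field_simp
      rw [e1] at r0
      linear_combination -r0
    have e1' : coeffOne x m = (lam 0)⁻¹ + (lam 1)⁻¹ := by
      rw [e1, e2]; field_simp; ring
    -- Negative `t` avoids both roots of `A` and the point `0`. The identity is affine in `t`, so
    -- the values at `-1` and `-2` determine both coefficients.
    have hval : ∀ t : ℝ, t < 0 → ∀ a,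
        -(Real.exp (x 0) * m 0 a + m 1 a * (Real.exp (x 1) - slope x m * t)) * (lam 0 * lam 1) =
          b 0 a * (t - lam 1) + b 1 a * (t - lam 0) := by
      intro t ht a
      obtain ⟨hA, hB⟩ := hS.eval_eq hx (ζ := (t : ℂ)) (by exact_mod_cast ht.ne)
      have hfac : 1 - coeffOne x m * t + coeffTwo x m * t ^ 2 =
          (t - lam 0) * (t - lam 1) / (lam 0 * lam 1) := by
        rw [e1', e2]; field_simp; ring
      have hn0 : t - lam 0 ≠ 0 := by linarith
      have hn1 : t - lam 1 ≠ 0 := by linarith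
      have hAr : A.eval (t : ℂ) = (((t - lam 0) * (t - lam 1) / (lam 0 * lam 1) : ℝ) : ℂ) := by
        rw [hA, eval_polyA, ← hfac]; push_cast; ring
      have hne : A.eval (t : ℂ) ≠ 0 := by
        rw [hAr]
        exact_mod_cast div_ne_zero (mul_ne_zero hn0 hn1) (mul_pos h0 h1).ne'
      have := hW t hne a
      rw [hAr, hB a, eval_polyB, Fin.sum_univ_two] at this
      have h' : -((Real.exp (x 0) * m 0 a + m 1 a * (Real.exp (x 1) - slope x m * t)) /
          ((t - lam 0) * (t - lam 1) / (lam 0 * lam 1))) =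
          b 0 a / (t - lam 0) + b 1 a / (t - lam 1) := by exact_mod_cast this
      field_simp at h'
      linear_combination h'
    refine ⟨e2, e1', fun a => ?_, fun a => ?_⟩
    · have u := hval (-1) (by norm_num) a
      have v := hval (-2) (by norm_num) a
      field_simp
      linear_combination v - 2 * u
    · have u := hval (-1) (by norm_num) a
      have v := hval (-2) (by norm_num) a
      field_simp
      linear_combination u - v
  · rintro ⟨e2, e1, e3, e4⟩
    have hA : ∀ ζ : ℂ, (polyA x m).eval ζ = (ζ - lam 0) * (ζ - lam 1) / (lam 0 * lam 1) := by
      intro ζ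
      have c0 : (lam 0 : ℂ) ≠ 0 := by exact_mod_cast h0.ne'
      have c1 : (lam 1 : ℂ) ≠ 0 := by exact_mod_cast h1.ne'
      rw [eval_polyA, e1, e2]; push_cast; field_simp; ring
    have c0 : (lam 0 : ℂ) ≠ 0 := by exact_mod_cast h0.ne'
    have c1 : (lam 1 : ℂ) ≠ 0 := by exact_mod_cast h1.ne'
    refine ⟨hlam, ?_, polyA x m, polyB x m, polyC x m, isScattering_poly m hx, ?_⟩
    · ext ζ
      simp only [Set.mem_ofPred_eq, Set.mem_range, Fin.exists_fin_two, isEigenvalue_iff hx]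
      have hz : (∃ z : ℂ, (polyA x m).eval (-z ^ 2) = 0 ∧ ζ = -z ^ 2) ↔
          (polyA x m).eval ζ = 0 := by
        constructor
        · rintro ⟨z, hz, rfl⟩; exact hz
        · intro h
          obtain ⟨z, hz⟩ := IsAlgClosed.exists_pow_nat_eq (-ζ) (n := 2) (by norm_num)
          have hz' : ζ = -z ^ 2 := by rw [hz]; ring
          exact ⟨z, hz' ▸ h, hz'⟩
      rw [hz, hA]
      rw [@eq_comm _ _ ζ, @eq_comm _ _ ζ]
      simp [c0, c1, sub_eq_zero]
    · intro ζ hζ a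
      have hn : (ζ - lam 0) ≠ 0 ∧ (ζ - lam 1) ≠ 0 := by
        constructor <;> intro h <;> simp [hA, h] at hζ
      obtain ⟨n0, n1⟩ := hn
      have e3' : (Real.exp (x 0) * m 0 a + Real.exp (x 1) * m 1 a : ℂ) =
        (lam 0 : ℂ)⁻¹ * b 0 a + (lam 1 : ℂ)⁻¹ * b 1 a := by exact_mod_cast e3 a
      have e4' : (slope x m * m 1 a : ℂ) =
        (lam 0 : ℂ)⁻¹ * (lam 1 : ℂ)⁻¹ * (b 0 a + b 1 a) := by exact_mod_cast e4 a
      have eB : (polyB x m a).eval ζ = ((lam 0 : ℂ)⁻¹ * b 0 a + (lam 1 : ℂ)⁻¹ * b 1 a) -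
          (lam 0 : ℂ)⁻¹ * (lam 1 : ℂ)⁻¹ * (b 0 a + b 1 a) * ζ := by
        rw [eval_polyB]; linear_combination e3' - ζ * e4'
      rw [hA, eB, Fin.sum_univ_two]
      field_simp
      ring

/-! ### The inverse problem. -/

/-- The first component of the vector `μ b + ν c - s (b + c)`, which is `exp (x 0)` times the mass
at `x 0`. The second component is `residual_snd`. -/
lemma residual_fst (b c : Fin 2 → ℝ) (μ ν s : ℝ)
    (hs : (μ + ν) * pairing (b + c) (b + c) * s = μ * ν * pairing (b + c) (b + c) +
      pairing (μ • b + ν • c) (μ • b + ν • c)) :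
    (μ + ν) * pairing (b + c) (b + c) * (μ * b 0 + ν * c 0 - s * (b 0 + c 0)) =
      2 * (ν - μ) * (b 0 + c 0) * (ν * (b 1 * c 0) - μ * (b 0 * c 1)) := by
  simp only [pairing, Pi.add_apply, Pi.smul_apply, smul_eq_mul] at *
  linear_combination (-(b 0 + c 0)) * hs

lemma residual_snd (b c : Fin 2 → ℝ) (μ ν s : ℝ)
    (hs : (μ + ν) * pairing (b + c) (b + c) * s = μ * ν * pairing (b + c) (b + c) +
      pairing (μ • b + ν • c) (μ • b + ν • c)) :
    (μ + ν) * pairing (b + c) (b + c) * (μ * b 1 + ν * c 1 - s * (b 1 + c 1)) =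
      2 * (ν - μ) * (b 1 + c 1) * (ν * (b 0 * c 1) - μ * (b 1 * c 0)) := by
  simp only [pairing, Pi.add_apply, Pi.smul_apply, smul_eq_mul] at *
  linear_combination (-(b 1 + c 1)) * hs

lemma pairing_pos {u w : Fin 2 → ℝ} (hu : ∀ a, 0 < u a) (hw : ∀ a, 0 < w a) :
    0 < pairing u w := by
  have := mul_pos (hu 0) (hw 1)
  have := mul_pos (hu 1) (hw 0)
  unfold pairing; linarith

/-- The hypothesis `hs` determines `s`, which will be `⟨m₂, m₂⟩`. The factors `(μ + ν) ⟨b + c, b +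
c⟩` and `2 (ν - μ) (b + c)` are positive, so only the last factors decide the sign. -/
lemma residual_pos_iff {b c : Fin 2 → ℝ} {μ ν s : ℝ} (hb : ∀ a, 0 < b a) (hc : ∀ a, 0 < c a)
    (hμ : 0 < μ) (hμν : μ < ν)
    (hs : (μ + ν) * pairing (b + c) (b + c) * s = μ * ν * pairing (b + c) (b + c) +
      pairing (μ • b + ν • c) (μ • b + ν • c)) :
    (∀ a, 0 < μ * b a + ν * c a - s * (b a + c a)) ↔
      μ * (b 0 * c 1) < ν * (b 1 * c 0) ∧ μ * (b 1 * c 0) < ν * (b 0 * c 1) := by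
  have hbc : ∀ a, 0 < (b + c) a := fun a => add_pos (hb a) (hc a)
  have hP : 0 < (μ + ν) * pairing (b + c) (b + c) :=
    mul_pos (by linarith) (pairing_pos hbc hbc)
  have h0 : 0 < 2 * (ν - μ) * (b 0 + c 0) := mul_pos (by linarith) (hbc 0)
  have h1 : 0 < 2 * (ν - μ) * (b 1 + c 1) := mul_pos (by linarith) (hbc 1)
  rw [Fin.forall_fin_two, ← mul_pos_iff_of_pos_left hP,
    ← mul_pos_iff_of_pos_left hP (b := _ - s * (b 1 + c 1)), residual_fst b c μ ν s hs,
    residual_snd b c μ ν s hs, mul_pos_iff_of_pos_left h0, mul_pos_iff_of_pos_left h1, sub_pos,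
    sub_pos]

lemma exists_mass_iff {b c : Fin 2 → ℝ} {μ ν : ℝ} (hb : ∀ a, 0 < b a) (hc : ∀ a, 0 < c a)
    (hμ : 0 < μ) (hμν : μ < ν) :
    (∃ (x : Fin 2 → ℝ) (m : Fin 2 → Fin 2 → ℝ), x 0 < x 1 ∧ (∀ k a, 0 < m k a) ∧
      coeffTwo x m = μ * ν ∧ coeffOne x m = μ + ν ∧
      (∀ a, Real.exp (x 0) * m 0 a + Real.exp (x 1) * m 1 a = μ * b a + ν * c a) ∧
      ∀ a, slope x m * m 1 a = μ * ν * (b a + c a)) ↔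
    μ * (b 0 * c 1) < ν * (b 1 * c 0) ∧ μ * (b 1 * c 0) < ν * (b 0 * c 1) := by
  have hbc : ∀ a, 0 < (b + c) a := fun a => add_pos (hb a) (hc a)
  have hν : 0 < ν := hμ.trans hμν
  have hP := pairing_pos hbc hbc
  have hR : 0 < pairing (μ • b + ν • c) (μ • b + ν • c) := by
    have : ∀ a, 0 < (μ • b + ν • c) a := fun a =>
      add_pos (mul_pos hμ (hb a)) (mul_pos hν (hc a))
    exact pairing_pos this this
  constructor
  · rintro ⟨x, m, hx, hm, e2, e1, e3, e4⟩
    have hh := pairing_pos (hm 1) (hm 1)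
    have eq : Real.exp (x 1) * Real.exp (-x 1) = 1 := by rw [← Real.exp_add]; simp
    have hp := Real.exp_pos (x 0)
    -- This rests on `slope · ⟨m₂, m₂⟩ = exp (x 1) · coeffTwo = exp (x 1) · μν`.
    have hv : ∀ a, Real.exp (x 1) * m 1 a = pairing (m 1) (m 1) * (b a + c a) := by
      intro a
      apply mul_left_cancel₀ (mul_pos hμ hν).ne'
      have := e4 a
      unfold slope coeffTwo at *
      generalize Real.exp (x 0) = p at *
      generalize Real.exp (x 1) = q at *
      generalize Real.exp (-x 1) = q' at *
      linear_combination pairing (m 1) (m 1) * this - q * m 1 a * e2 -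
        pairing (m 0) (m 0) * pairing (m 1) (m 1) * m 1 a * p ^ 2 * q' * eq
    have hu : ∀ a, Real.exp (x 0) * m 0 a =
        μ * b a + ν * c a - pairing (m 1) (m 1) * (b a + c a) := by
      intro a; linear_combination e3 a - hv a
    refine (residual_pos_iff hb hc hμ hμν (s := pairing (m 1) (m 1)) ?_).1 fun a => ?_
    · have hq : Real.exp (x 1) ^ 2 = pairing (m 1) (m 1) * pairing (b + c) (b + c) := by
        apply mul_left_cancel₀ hh.ne'
        have h0 := hv 0
        have h1 := hv 1
        simp only [pairing, Pi.add_apply] at *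
        generalize Real.exp (x 1) = q at *
        linear_combination (2 * q * m 1 1) * h0 +
          2 * (m 1 0 * m 1 1 + m 1 1 * m 1 0) * (b 0 + c 0) * h1
      have hU : pairing (μ • b + ν • c) (μ • b + ν • c) =
          Real.exp (x 0) ^ 2 * pairing (m 0) (m 0) +
          2 * Real.exp (x 0) * Real.exp (x 1) * pairing (m 0) (m 1) +
          Real.exp (x 1) ^ 2 * pairing (m 1) (m 1) := by
        simp only [pairing, Pi.add_apply, Pi.smul_apply, smul_eq_mul]
        rw [← e3 0, ← e3 1]; ring
      rw [hU]
      unfold coeffOne coeffTwo at *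
      generalize pairing (b + c) (b + c) = P at *
      generalize pairing (m 0) (m 0) = h0 at *
      generalize pairing (m 1) (m 1) = h1 at *
      generalize pairing (m 0) (m 1) = k at *
      generalize Real.exp (x 0) = p at *
      generalize Real.exp (x 1) = q at *
      generalize Real.exp (-x 1) = q' at *
      -- The equation for `coeffOne` times `q²`; with `q² = s P` it is the equation that determines
      -- `s`.
      have : (μ + ν) * q ^ 2 = μ * ν * P + (p ^ 2 * h0 + 2 * p * q * k + q ^ 2 * h1) := by
        have e2' : μ * ν * P = h0 * (q ^ 2 - p ^ 2) := by
          rw [← e2]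
          linear_combination (-h0 * (1 - (p * q') ^ 2)) * hq - h0 * p ^ 2 * (q * q' + 1) * eq
        rw [← e1, e2']
        linear_combination 2 * p * q * k * eq
      rw [← this, hq]; ring
    · rw [← hu]; exact mul_pos hp (hm 0 a)
  · intro h
    set P := pairing (b + c) (b + c) with hPd
    set R := pairing (μ • b + ν • c) (μ • b + ν • c) with hRd
    -- The values forced by the direct argument: `s = ⟨m₂, m₂⟩`, `u = p m₁`, `t = ⟨m₁, m₁⟩`, `q² = s
    -- P`, and `p² = H / t` because `⟨u, u⟩ = p² t`.
    obtain ⟨s, hsd⟩ : ∃ s, s = (μ * ν + R / P) / (μ + ν) := ⟨_, rfl⟩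
    have hs : 0 < s := by rw [hsd]; positivity
    have hsP : (μ + ν) * P * s = μ * ν * P + R := by rw [hsd]; field_simp
    have hu := (residual_pos_iff hb hc hμ hμν hsP).2 h
    obtain ⟨u, hud⟩ : ∃ u : Fin 2 → ℝ, u = fun a => μ * b a + ν * c a - s * (b a + c a) := ⟨_, rfl⟩
    have hua : ∀ a, μ * b a + ν * c a - s * (b a + c a) = u a := fun a => by rw [hud]
    simp only [hua] at hu
    have hH := pairing_pos hu hu
    set H := pairing u u with hHd
    obtain ⟨t, htd⟩ : ∃ t, t = (μ * ν + H / P) / s := ⟨_, rfl⟩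
    have ht : 0 < t := by rw [htd]; positivity
    have htP : t * s * P = μ * ν * P + H := by rw [htd]; field_simp
    obtain ⟨p, hp0, hp⟩ : ∃ p, 0 < p ∧ p ^ 2 = H / t :=
      ⟨√(H / t), Real.sqrt_pos.2 (by positivity), Real.sq_sqrt (by positivity)⟩
    obtain ⟨q, hq0, hq⟩ : ∃ q, 0 < q ∧ q ^ 2 = s * P :=
      ⟨√(s * P), Real.sqrt_pos.2 (by positivity), Real.sq_sqrt (by positivity)⟩
    have hpt : t * p ^ 2 = H := by rw [hp]; field_simp
    -- This is `t (q² - p²) = μνP > 0`.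
    have hpq : p < q := by
      refine lt_of_pow_lt_pow_left₀ 2 hq0.le ?_
      have : t * p ^ 2 < t * q ^ 2 := by
        have := mul_pos (mul_pos hμ hν) hP
        rw [hpt, hq, ← mul_assoc, htP]; linarith
      exact lt_of_mul_lt_mul_left this ht.le
    let m : Fin 2 → Fin 2 → ℝ := ![fun a => u a / p, fun a => s * (b a + c a) / q]
    have m0 : ∀ a, m 0 a = u a / p := fun a => rfl
    have m1 : ∀ a, m 1 a = s * (b a + c a) / q := fun a => rfl
    have h00 : pairing (m 0) (m 0) = t := by
      have : pairing (m 0) (m 0) = H / p ^ 2 := by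
        rw [hHd]; simp only [pairing, m0]; field_simp
      rw [this, ← hpt]; field_simp
    have h11 : pairing (m 1) (m 1) = s := by
      have : pairing (m 1) (m 1) = s ^ 2 * P / q ^ 2 := by
        rw [hPd]; simp only [pairing, m1, Pi.add_apply]; field_simp
      rw [this, hq]; field_simp
    -- Expand `R` as the pairing of `u + s (b + c)` with itself.
    have h01 : 2 * pairing (m 0) (m 1) * (p * q) = R - H - s ^ 2 * P := by
      have : pairing (m 0) (m 1) * (p * q) = s * pairing u (b + c) := by
        simp only [pairing, m0, m1, Pi.add_apply]; field_simp
      rw [mul_assoc, this, hRd, hHd, hPd, hud]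
      simp only [pairing, Pi.add_apply, Pi.smul_apply, smul_eq_mul]; ring
    have ex0 : Real.exp (Real.log p) = p := Real.exp_log hp0
    have ex1 : Real.exp (Real.log q) = q := Real.exp_log hq0
    have ex1' : Real.exp (-Real.log q) = q⁻¹ := by rw [Real.exp_neg, ex1]
    -- The equation for `coeffTwo` times `q²`; the `slope` equation also follows from it.
    have key : t * s * (q ^ 2 - p ^ 2) = μ * ν * q ^ 2 := by
      rw [hq]; linear_combination s * htP - s * hpt
    refine ⟨![Real.log p, Real.log q], m, ?_, ?_, ?_, ?_, ?_, ?_⟩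
    · simpa using Real.log_lt_log hp0 hpq
    · rw [Fin.forall_fin_two]
      exact ⟨fun a => by rw [m0]; exact div_pos (hu a) hp0,
        fun a => by rw [m1]; exact div_pos (mul_pos hs (hbc a)) hq0⟩
    · simp only [coeffTwo, h00, h11, Matrix.cons_val_zero, Matrix.cons_val_one, ex0, ex1']
      field_simp
      linear_combination key
    · simp only [coeffOne, h00, h11, Matrix.cons_val_zero, Matrix.cons_val_one, ex0, ex1']
      field_simp
      apply mul_left_cancel₀ hq0.ne'
      linear_combination h01 + (t + s - μ - ν) * hq + htP - hsP
    · intro a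
      simp only [Matrix.cons_val_zero, Matrix.cons_val_one, ex0, ex1, m0, m1]
      field_simp
      rw [← hua]; ring
    · intro a
      simp only [slope, h00, Matrix.cons_val_zero, Matrix.cons_val_one, ex0, ex1, ex1', m1]
      field_simp
      linear_combination (b a + c a) * key

lemma mem_spectralData_iff {lam : Fin 2 → ℝ} {b : Fin 2 → Fin 2 → ℝ}
    (hext : (lam, b) ∈ extendedSpectralData 2) :
    (lam, b) ∈ spectralData 2 ↔
      lam 1 * (b 0 0 * b 1 1) < lam 0 * (b 0 1 * b 1 0) ∧
      lam 1 * (b 0 1 * b 1 0) < lam 0 * (b 0 0 * b 1 1) := by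
  obtain ⟨hanti, hpos, hb⟩ := hext
  have h0 : 0 < lam 0 := hpos 0
  have h1 : 0 < lam 1 := hpos 1
  have h01 : lam 1 < lam 0 := hanti (by simp)
  have key := exists_mass_iff (hb 0) (hb 1) (inv_pos.2 h0) ((inv_lt_inv₀ h0 h1).2 h01)
  have hscale : ∀ s t : ℝ, (lam 0)⁻¹ * s < (lam 1)⁻¹ * t ↔ lam 1 * s < lam 0 * t := by
    intro s t
    rw [inv_mul_eq_div, inv_mul_eq_div, div_lt_div_iff₀ h0 h1, mul_comm s, mul_comm t]
  rw [hscale, hscale] at key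
  rw [← key]
  have hmono : ∀ x : Fin 2 → ℝ, StrictMono x ↔ x 0 < x 1 := fun x => by
    simp [Fin.strictMono_iff_lt_succ]
  constructor
  · rintro ⟨x, m, hx, hm, h⟩
    rw [hmono] at hx
    exact ⟨x, m, hx, hm, (hasSpectralData_iff hx hanti hpos).1 h⟩
  · rintro ⟨x, m, hx, hm, h⟩
    exact ⟨x, m, (hmono x).2 hx, hm, (hasSpectralData_iff hx hanti hpos).2 h⟩

/-! ### The three determinantal and bilinear criteria. -/

lemma pairing_L (lam : Fin 2 → ℝ) (u w : Fin 2 → ℝ) :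
    pairing u ((L lam).mulVec w) = lam 0 * (u 1 * w 0) - lam 1 * (u 0 * w 1) := by
  simp [pairing, L, Matrix.mulVec_diagonal]; ring

lemma vecDet_two (v : Fin 2 → Fin 2 → ℝ) (M : Matrix (Fin 2) (Fin 1) ℝ) (a : Fin 2) :
    vecDet v M a = v 0 a * M 1 0 - M 0 0 * v 1 a := by
  simp [vecDet, Matrix.det_fin_two]

/-- Here `1 - a` is the other component index. Once the denominator `λ₁ + λ₂` is cleared the
determinant factors, and only the last factor can change sign. -/
lemma G_two_apply (lam : Fin 2 → ℝ) (b : Fin 2 → Fin 2 → ℝ) (hpos : ∀ k, 0 < lam k) (a : Fin 2) :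
    G lam b 2 1 0 a * (lam 0 + lam 1) = (lam 0 - lam 1) * (b 0 a + b 1 a) *
      (lam 0 * (b 0 (1 - a) * b 1 a) - lam 1 * (b 0 a * b 1 (1 - a))) := by
  have h0 := hpos 0
  have h1 := hpos 1
  simp only [G]
  rw [vecDet_two]
  simp only [vecMoment, biMoment, Fin.sum_univ_two, Matrix.of_apply]
  fin_cases a <;> simp [pairing] <;> field_simp <;> ring

lemma StrictMono.fin_two_eq {f : Fin 2 → Fin 2} (hf : StrictMono f) : f 0 = 0 ∧ f 1 = 1 := by
  have : f 0 < f 1 := hf (by simp)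
  omega

/-- The entries are always positive and there are only two rows, so the minors of order two decide.
Each vector-valued one is, in either component, a positive multiple of one of the two differences;
the scalar one is a positive multiple of their product. -/
lemma isTotallyPositive_iff {lam : Fin 2 → ℝ} {b : Fin 2 → Fin 2 → ℝ} (hpos : ∀ k, 0 < lam k)
    (hb : ∀ k a, 0 < b k a) :
    IsTotallyPositive (lambda2Vec lam b) (lambda2Mat lam b) ↔
      lam 1 * (b 0 0 * b 1 1) < lam 0 * (b 0 1 * b 1 0) ∧
      lam 1 * (b 0 1 * b 1 0) < lam 0 * (b 0 0 * b 1 1) := by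
  have h0 := hpos 0
  have h1 := hpos 1
  have b00 := hb 0 0
  have b01 := hb 0 1
  have b10 := hb 1 0
  have b11 := hb 1 1
  have hv : ∀ p a, 0 < lambda2Vec lam b p a := fun p a => div_pos (hb _ _) (hpos _)
  have hM : ∀ p q, 0 < lambda2Mat lam b p q := fun p q =>
    div_pos (pairing_pos (hb _) (hb _)) (add_pos (hpos _) (hpos _))
  have r0 : Fin.rev (0 : Fin 2) = 1 := rfl
  have r1 : Fin.rev (1 : Fin 2) = 0 := rfl
  have d00 : lambda2Vec lam b 0 0 * lambda2Mat lam b 1 0 -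
      lambda2Mat lam b 0 0 * lambda2Vec lam b 1 0 =
      b 1 0 / (lam 0 * lam 1 * (lam 0 + lam 1)) *
        (lam 0 * (b 0 1 * b 1 0) - lam 1 * (b 0 0 * b 1 1)) := by
    simp only [lambda2Vec, lambda2Mat, Matrix.of_apply, pairing, r0, r1]
    field_simp; ring
  have d01 : lambda2Vec lam b 0 1 * lambda2Mat lam b 1 0 -
      lambda2Mat lam b 0 0 * lambda2Vec lam b 1 1 =
      b 1 1 / (lam 0 * lam 1 * (lam 0 + lam 1)) *
        (lam 0 * (b 0 0 * b 1 1) - lam 1 * (b 0 1 * b 1 0)) := by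
    simp only [lambda2Vec, lambda2Mat, Matrix.of_apply, pairing, r0, r1]
    field_simp; ring
  have d10 : lambda2Vec lam b 0 0 * lambda2Mat lam b 1 1 -
      lambda2Mat lam b 0 1 * lambda2Vec lam b 1 0 =
      b 0 0 / (lam 0 * lam 1 * (lam 0 + lam 1)) *
        (lam 0 * (b 0 1 * b 1 0) - lam 1 * (b 0 0 * b 1 1)) := by
    simp only [lambda2Vec, lambda2Mat, Matrix.of_apply, pairing, r0, r1]
    field_simp; ring
  have d11 : lambda2Vec lam b 0 1 * lambda2Mat lam b 1 1 -
      lambda2Mat lam b 0 1 * lambda2Vec lam b 1 1 =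
      b 0 1 / (lam 0 * lam 1 * (lam 0 + lam 1)) *
        (lam 0 * (b 0 0 * b 1 1) - lam 1 * (b 0 1 * b 1 0)) := by
    simp only [lambda2Vec, lambda2Mat, Matrix.of_apply, pairing, r0, r1]
    field_simp; ring
  have dM : lambda2Mat lam b 0 0 * lambda2Mat lam b 1 1 -
      lambda2Mat lam b 0 1 * lambda2Mat lam b 1 0 =
      1 / (lam 0 * lam 1 * (lam 0 + lam 1) ^ 2) *
        ((lam 0 * (b 0 1 * b 1 0) - lam 1 * (b 0 0 * b 1 1)) *
        (lam 0 * (b 0 0 * b 1 1) - lam 1 * (b 0 1 * b 1 0))) := by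
    simp only [lambda2Mat, Matrix.of_apply, pairing, r0, r1]
    field_simp; ring
  constructor
  · rintro ⟨-, h⟩
    -- The vector column with the first scalar column suffices: its two components are the two
    -- inequalities.
    have hd := h 1 id (fun _ => 0) strictMono_id (Subsingleton.strictMono _)
    have e0 := hd 0
    have e1 := hd 1
    rw [vecDet_two] at e0 e1
    simp only [id, Matrix.submatrix_apply] at e0 e1
    rw [d00, mul_pos_iff_of_pos_left (by positivity), sub_pos] at e0
    rw [d01, mul_pos_iff_of_pos_left (by positivity), sub_pos] at e1
    exact ⟨e0, e1⟩
  · rintro ⟨e0, e1⟩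
    rw [← sub_pos] at e0 e1
    constructor
    · intro k f g hf hg
      have hk : k ≤ 2 := by simpa using Fintype.card_le_of_injective f hf.injective
      interval_cases k
      · simp
      · simpa using hM _ _
      · obtain ⟨f0, f1⟩ := StrictMono.fin_two_eq hf
        obtain ⟨g0, g1⟩ := StrictMono.fin_two_eq hg
        rw [Matrix.det_fin_two]
        simp only [Matrix.submatrix_apply, f0, f1, g0, g1]
        rw [dM]; positivity
    · intro k f g hf hg a
      have hk : k + 1 ≤ 2 := by simpa using Fintype.card_le_of_injective f hf.injective
      have hk' : k ≤ 1 := by omega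
      interval_cases k
      -- For `k = 0` the submatrix is a single entry of the vector column.
      · simpa [vecDet] using hv _ a
      · obtain ⟨f0, f1⟩ := StrictMono.fin_two_eq hf
        rw [vecDet_two]
        simp only [Matrix.submatrix_apply, f0, f1]
        generalize g 0 = j
        fin_cases a <;> fin_cases j <;> simp only [Fin.zero_eta, Fin.mk_one, Fin.isValue]
        · rw [d00]; positivity
        · rw [d10]; positivity
        · rw [d01]; positivity
        · rw [d11]; positivity

end NV2

theorem mainTheorem11 (lam : Fin 2 → ℝ) (b : Fin 2 → Fin 2 → ℝ)
    (hext : (lam, b) ∈ NV2.extendedSpectralData 2) :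
    ((lam, b) ∈ NV2.spectralData 2 ↔
      0 < NV2.pairing (b 0) ((NV2.L lam).mulVec (b 1)) ∧
      0 < NV2.pairing (b 1) ((NV2.L lam).mulVec (b 0))) ∧
    ((lam, b) ∈ NV2.spectralData 2 ↔ ∀ a, 0 < NV2.G lam b 2 1 0 a) ∧
    ((lam, b) ∈ NV2.spectralData 2 ↔
      NV2.IsTotallyPositive (NV2.lambda2Vec lam b) (NV2.lambda2Mat lam b)) := by
  rw [NV2.mem_spectralData_iff hext]
  obtain ⟨hanti, hpos, hb⟩ := hext
  have h01 : lam 1 < lam 0 := hanti (by simp)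
  have hsum : 0 < lam 0 + lam 1 := add_pos (hpos 0) (hpos 1)
  refine ⟨?_, ?_, (NV2.isTotallyPositive_iff hpos hb).symm⟩
  · rw [NV2.pairing_L, NV2.pairing_L, sub_pos, sub_pos, mul_comm (b 1 1), mul_comm (b 1 0)]
  · have hG : ∀ a, 0 < NV2.G lam b 2 1 0 a ↔
        lam 1 * (b 0 a * b 1 (1 - a)) < lam 0 * (b 0 (1 - a) * b 1 a) := by
      intro a
      rw [← mul_pos_iff_of_pos_right hsum, NV2.G_two_apply lam b hpos,
        mul_pos_iff_of_pos_left (mul_pos (sub_pos.2 h01) (add_pos (hb 0 a) (hb 1 a))), sub_pos]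
    rw [Fin.forall_fin_two, hG, hG]
    simp
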